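/- Let $n\ge 1$, let $B$ be the open unit ball of $\mathbb R^n$, and let $G(t)=\int_0^t g(\tau)\,d\tau$ be an N-function: $g:[0,\infty)\to[0,\infty)$ is right-continuous and non-decreasing, $g(0)=0$, $g(t)>0$ for $t>0$, and $g(t)\to\infty$ as $t\to\infty$. Assume that there are constants $p^-,p^+$ such that $1<p^-\le \frac{t\,g(t)}{G(t)}\le p^+<\infty$ for all $t>0$. Let $\widetilde G(t)=\sup_{w>0}\,(tw-G(w))$ be the complementary function. For an N-function $A$ and a measure $\mu$ write $\|f\|_{L^{A}(\mu)}=\inf\{\lambda>0:\int A(|f|/\lambda)\,d\mu\le 1\}$ for the Luxemburg norm. Let $W^{1,G}_0(B)$ be the closure of $C_c^\infty(B)$ in $W^{1,G}(B)=\{u\in L^G(B):|\nabla u|\in L^G(B)\}$ with respect to the norm $\|u\|_{L^G(B)}+\|\nabla u\|_{L^G(B)}$ (with $\nabla u$ the weak gradient). There is a constant $C>0$, depending only on $n$ (and in particular not on $G$), such that every radial $u\in W^{1,G}_0(B)$ has a representative that is radial and continuous on $B\setminus\{0\}$, and this representative satisfies $$|u(x)|\le C\,\|\nabla u\|_{L^G(B)}\,\|s^{1-n}\|_{L^{\widetilde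 G}((|x|,1),\,s^{n-1}ds)}\qquad\text{for all } x \text{ with } 0<|x|<1 .$$ Moreover, in the power case $G(t)=t^p$ with $1<p<n$, there is a constant $C>0$ depending only on $n$ and $p$ such that every radial $u\in W^{1,p}_0(B)$ has a representative that is radial and continuous on $B\setminus\{0\}$ and satisfies $$|u(x)|\le C\,|x|^{1-n/p}\,\|\nabla u\|_{L^p(B)}\qquad\text{for all } x \text{ with } 0<|x|<1 .$$ -/

import Mathlib

open MeasureTheory Set Filter Topology
open scoped ENNReal ContDiff

noncomputable section

namespace OrliczRadial

/-- `G` is an N-function with density `g`: `G t = ∫₀ᵗ g`, where `g` is right-continuous on `[0, ∞)`,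
positive on `(0, ∞)`, non-decreasing, `g 0 = 0` and `g t → ∞`. Only the values on `[0, ∞)` of
`G` and `g` are used. -/
structure IsNFunction (G g : ℝ → ℝ) : Prop where
  rightContinuous : ∀ t, 0 ≤ t → ContinuousWithinAt g (Ici t) t
  pos : ∀ t, 0 < t → 0 < g t
  mono : MonotoneOn g (Ici 0)
  map_zero : g 0 = 0
  tendsto_atTop : Tendsto g atTop atTop
  eq_integral : ∀ t, 0 ≤ t → G t = ∫ τ in (0 : ℝ)..t, g τ

/-- The growth condition `1 < p⁻ ≤ t g(t) / G(t) ≤ p⁺ < ∞` for all `t > 0`. -/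
def GrowthCondition (G g : ℝ → ℝ) : Prop :=
  ∃ pm pp : ℝ, 1 < pm ∧ ∀ t, 0 < t → pm ≤ t * g t / G t ∧ t * g t / G t ≤ pp

/-- The complementary function `t ↦ sup {t w - G w : w > 0}`. -/
def complementary (G : ℝ → ℝ) (t : ℝ) : ℝ :=
  sSup {y : ℝ | ∃ w : ℝ, 0 < w ∧ y = t * w - G w}

section Orlicz

variable {α F : Type*} [MeasurableSpace α] [NormedAddCommGroup F]

/-- Membership in the Orlicz space `L^G(μ)`: finite modular `∫ G(|f|) dμ`. -/
def MemOrlicz (G : ℝ → ℝ) (μ : Measure α) (f : α → F) : Prop :=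
  AEStronglyMeasurable f μ ∧ ∫⁻ x, ENNReal.ofReal (G ‖f x‖) ∂μ < ⊤

/-- The Luxemburg norm `inf {l > 0 : ∫ G(|f| / l) dμ ≤ 1}`, with value `∞` if there is no
such `l`. -/
def eLuxemburgNorm (G : ℝ → ℝ) (μ : Measure α) (f : α → F) : ℝ≥0∞ :=
  ⨅ (l : ℝ) (_ : 0 < l ∧ ∫⁻ x, ENNReal.ofReal (G (‖f x‖ / l)) ∂μ ≤ 1), ENNReal.ofReal l

/-- The Luxemburg norm as a real number. -/
def luxemburgNorm (G : ℝ → ℝ) (μ : Measure α) (f : α → F) : ℝ :=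
  (eLuxemburgNorm G μ f).toReal

end Orlicz

/-- `φ ∈ C_c^∞(Ω)`. -/
def IsTestFunction {n : ℕ} (Ω : Set (EuclideanSpace ℝ (Fin n)))
    (φ : EuclideanSpace ℝ (Fin n) → ℝ) : Prop :=
  ContDiff ℝ ∞ φ ∧ HasCompactSupport φ ∧ tsupport φ ⊆ Ω

/-- `V` is the weak gradient of `u` in `Ω` (unique up to null sets): `∫ u ∇φ = - ∫ φ V` for all
test functions `φ`. -/
def HasWeakGradient {n : ℕ} (Ω : Set (EuclideanSpace ℝ (Fin n)))
    (u : EuclideanSpace ℝ (Fin n) → ℝ)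
    (V : EuclideanSpace ℝ (Fin n) → EuclideanSpace ℝ (Fin n)) : Prop :=
  LocallyIntegrableOn u Ω ∧ LocallyIntegrableOn V Ω ∧
    ∀ φ : EuclideanSpace ℝ (Fin n) → ℝ, IsTestFunction Ω φ →
      ∫ x in Ω, u x • gradient φ x = - ∫ x in Ω, φ x • V x

/-- `u ∈ W^{1,G}(Ω)` with weak gradient `V`. -/
def MemOrliczSobolev {n : ℕ} (G : ℝ → ℝ) (Ω : Set (EuclideanSpace ℝ (Fin n)))
    (u : EuclideanSpace ℝ (Fin n) → ℝ)
    (V : EuclideanSpace ℝ (Fin n) → EuclideanSpace ℝ (Fin n)) : Prop :=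
  HasWeakGradient Ω u V ∧ MemOrlicz G (volume.restrict Ω) u ∧ MemOrlicz G (volume.restrict Ω) V

/-- `u ∈ W₀^{1,G}(Ω)` with weak gradient `V`: `u` belongs to the closure of `C_c^∞(Ω)` in
`W^{1,G}(Ω)` for the norm `‖u‖_{L^G} + ‖∇u‖_{L^G}`. -/
def MemOrliczSobolevZero {n : ℕ} (G : ℝ → ℝ) (Ω : Set (EuclideanSpace ℝ (Fin n)))
    (u : EuclideanSpace ℝ (Fin n) → ℝ)
    (V : EuclideanSpace ℝ (Fin n) → EuclideanSpace ℝ (Fin n)) : Prop :=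
  MemOrliczSobolev G Ω u V ∧
    ∀ ε : ℝ≥0∞, 0 < ε → ∃ φ : EuclideanSpace ℝ (Fin n) → ℝ, IsTestFunction Ω φ ∧
      eLuxemburgNorm G (volume.restrict Ω) (fun x => u x - φ x) +
        eLuxemburgNorm G (volume.restrict Ω) (fun x => V x - gradient φ x) < ε

/-- The open unit ball of `ℝⁿ`. -/
abbrev unitBall (n : ℕ) : Set (EuclideanSpace ℝ (Fin n)) := Metric.ball 0 1

/-- `u` is (almost everywhere equal to) a function of `|x|` in the unit ball. -/
def IsRadial {n : ℕ} (u : EuclideanSpace ℝ (Fin n) → ℝ) : Prop :=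
  ∃ f : ℝ → ℝ, ∀ᵐ x ∂(volume.restrict (unitBall n)), u x = f ‖x‖

/-- `u ∈ X_rad(B)`, with weak gradient `V`: a radial element of `W₀^{1,G}(B)`. -/
def MemXrad {n : ℕ} (G : ℝ → ℝ) (u : EuclideanSpace ℝ (Fin n) → ℝ)
    (V : EuclideanSpace ℝ (Fin n) → EuclideanSpace ℝ (Fin n)) : Prop :=
  MemOrliczSobolevZero G (unitBall n) u V ∧ IsRadial u

/-- `v` is the representative of `u` that is radial and continuous on the punctured unit ball, for
which the pointwise values at `x ≠ 0` are meant. -/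
structure IsContinuousRadialRep {n : ℕ} (u v : EuclideanSpace ℝ (Fin n) → ℝ) : Prop where
  ae_eq : ∀ᵐ x ∂(volume.restrict (unitBall n)), v x = u x
  continuousOn : ContinuousOn v (unitBall n \ {0})
  radial : ∀ x ∈ unitBall n \ {0}, ∀ y ∈ unitBall n \ {0}, ‖x‖ = ‖y‖ → v x = v y

/-- The measure `s^{n-1} ds` on `(r, 1)` (for `n ≥ 1`). -/
def radialMeasure (n : ℕ) (r : ℝ) : Measure ℝ :=
  (volume.restrict (Ioo r 1)).withDensity (fun s => ENNReal.ofReal (s ^ (n - 1)))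

end OrliczRadial

end

open OrliczRadial

/-!
Let `σ` be the surface measure of the unit sphere and, for a test function `φ` on the unit ball, let
`m φ r = ∫ φ (r θ) dσ θ`. Since `φ` vanishes on the unit sphere, integrating its radial derivative
along the rays and passing to polar coordinates gives
`|m φ r| ≤ ∫_{r < ‖x‖ < 1} ‖∇φ x‖ ‖x‖ ^ (1 - n) dx`
(`IsTestFunction.enorm_sphericalIntegral_le`). Young's inequality for `G` and its complementary
function bounds the right-hand side by `K r * ‖∇φ‖`, where `K r` is `1 + σ univ` times the norm of
`s ^ (1 - n)` over `(r, 1)` (`IsNFunction.setLIntegral_mul_weight_le`). The weight is bounded on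
`(r, 1)`, so `K r` is finite, and it decreases in `r`.

Now let test functions `φ k` approximate `u`. By linearity the estimate applies to the differences
`φ j - φ k`, so that the functions `m (φ k)` are uniformly Cauchy on every `(r, 1)` and converge to
a continuous function `w` on `(0, 1)`, which inherits the estimate with the gradient of `u`. On the
other hand `φ k → u` in `L¹` of the ball, with summable errors if the `φ k` are chosen well, hence
on almost every sphere, where `u` is constant; so `w = σ univ * u` there
(`ae_tendsto_sphericalIntegral`). The representative is `x ↦ w ‖x‖ / σ univ`, and the constant is
`(1 + σ univ) / σ univ`. The argument never differentiates `u`: the radial profile is controlled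
through the approximating test functions only.

For `G t = t ^ p` the complementary function is at most `t ^ q` with `q` the conjugate exponent, and
the norm of the weight is estimated by an explicit integral (`luxemburgNorm_weight_rpow_le`).
-/

namespace OrliczRadial

/-! ### N-functions and their complementary functions -/

namespace IsNFunction

variable {G g : ℝ → ℝ}

lemma density_nonneg (h : IsNFunction G g) {t : ℝ} (ht : 0 ≤ t) : 0 ≤ g t := by
  rcases ht.eq_or_lt with rfl | ht
  · exact h.map_zero.ge
  · exact (h.pos t ht).le

lemma intervalIntegrable (h : IsNFunction G g) {a b : ℝ} (ha : 0 ≤ a) (hb : 0 ≤ b) :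
    IntervalIntegrable g volume a b :=
  (h.mono.mono fun _ hx => (le_min ha hb).trans hx.1).intervalIntegrable

lemma sub_eq_integral (h : IsNFunction G g) {a b : ℝ} (ha : 0 ≤ a) (hb : 0 ≤ b) :
    G b - G a = ∫ τ in a..b, g τ := by
  rw [h.eq_integral b hb, h.eq_integral a ha,
    intervalIntegral.integral_interval_sub_left (h.intervalIntegrable le_rfl hb)
      (h.intervalIntegrable le_rfl ha)]

lemma monotoneOn (h : IsNFunction G g) : MonotoneOn G (Ici 0) := by
  intro a ha b hb hab
  rw [← sub_nonneg, h.sub_eq_integral ha hb]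
  exact intervalIntegral.integral_nonneg hab fun τ hτ => h.density_nonneg (le_trans ha hτ.1)

lemma nonneg (h : IsNFunction G g) {t : ℝ} (ht : 0 ≤ t) : 0 ≤ G t := by
  rw [h.eq_integral t ht]
  exact intervalIntegral.integral_nonneg ht fun τ hτ => h.density_nonneg hτ.1

lemma div_le (h : IsNFunction G g) {t l : ℝ} (ht : 0 ≤ t) (hl : 1 ≤ l) :
    G (t / l) ≤ G t / l := by
  have hl0 : 0 < l := one_pos.trans_le hl
  have hint : IntervalIntegrable (fun τ => g (τ / l)) volume 0 t := by
    have hm : MonotoneOn (fun τ => g (τ / l)) (Ici 0) := fun a ha b hb hab =>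
      h.mono (div_nonneg ha hl0.le) (div_nonneg hb hl0.le) (by gcongr)
    exact (hm.mono fun _ hx => (le_min le_rfl ht).trans hx.1).intervalIntegrable
  have hle : ∫ τ in (0 : ℝ)..t, g (τ / l) ≤ ∫ τ in (0 : ℝ)..t, g τ :=
    intervalIntegral.integral_mono_on ht hint (h.intervalIntegrable le_rfl ht) fun τ hτ =>
      h.mono (div_nonneg hτ.1 hl0.le) hτ.1 (div_le_self hτ.1 hl)
  rw [intervalIntegral.integral_comp_div _ hl0.ne', zero_div, smul_eq_mul,
    ← h.eq_integral _ (div_nonneg ht hl0.le), ← h.eq_integral t ht] at hle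
  rwa [le_div_iff₀ hl0, mul_comm]

/-- The supremum that defines the complementary function is finite, because `g t → ∞`. -/
lemma bddAbove_complementary (h : IsNFunction G g) {t : ℝ} (ht : 0 ≤ t) :
    BddAbove {y : ℝ | ∃ w : ℝ, 0 < w ∧ y = t * w - G w} := by
  obtain ⟨T, hT0, hT⟩ : ∃ T, 0 ≤ T ∧ ∀ τ, T ≤ τ → t ≤ g τ := by
    obtain ⟨T, hT⟩ := eventually_atTop.1 (h.tendsto_atTop.eventually_ge_atTop t)
    exact ⟨max T 0, le_max_right _ _, fun τ hτ => hT τ ((le_max_left _ _).trans hτ)⟩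
  refine ⟨t * T, ?_⟩
  rintro _ ⟨w, hw, rfl⟩
  rcases le_total w T with hwT | hTw
  · nlinarith [h.nonneg hw.le, mul_le_mul_of_nonneg_left hwT ht]
  · have h1 : ∫ _ in T..w, t ≤ ∫ τ in T..w, g τ :=
      intervalIntegral.integral_mono_on hTw intervalIntegrable_const
        (h.intervalIntegrable hT0 hw.le) fun τ hτ => hT τ hτ.1
    rw [intervalIntegral.integral_const, smul_eq_mul, ← h.sub_eq_integral hT0 hw.le] at h1
    nlinarith [h.nonneg hT0]

/-- Young's inequality. -/
lemma mul_le_add_complementary (h : IsNFunction G g) {t w : ℝ} (ht : 0 ≤ t) (hw : 0 < w) :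
    w * t ≤ G w + complementary G t := by
  have := le_csSup (h.bddAbove_complementary ht) ⟨w, hw, rfl⟩
  unfold complementary
  linarith [mul_comm w t]

lemma ofReal_mul_le (h : IsNFunction G g) {t w : ℝ} (ht : 0 ≤ t) (hw : 0 ≤ w) :
    ENNReal.ofReal w * ENNReal.ofReal t ≤
      ENNReal.ofReal (G w) + ENNReal.ofReal (complementary G t) := by
  rcases hw.eq_or_lt with rfl | hw
  · simp
  · rw [← ENNReal.ofReal_mul hw.le]
    exact (ENNReal.ofReal_le_ofReal (h.mul_le_add_complementary ht hw)).trans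
      ENNReal.ofReal_add_le

lemma complementary_monotoneOn (h : IsNFunction G g) :
    MonotoneOn (complementary G) (Ici 0) := by
  intro s hs t ht hst
  refine csSup_le ⟨_, 1, one_pos, rfl⟩ ?_
  rintro _ ⟨w, hw, rfl⟩
  refine le_csSup_of_le (h.bddAbove_complementary ht) ⟨w, hw, rfl⟩ ?_
  gcongr

lemma complementary_div_le (h : IsNFunction G g) {t l : ℝ} (ht : 0 ≤ t) (hl : 1 ≤ l) :
    complementary G (t / l) ≤ complementary G t / l := by
  have hl0 : 0 < l := one_pos.trans_le hl
  refine csSup_le ⟨_, 1, one_pos, rfl⟩ ?_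
  rintro _ ⟨w, hw, rfl⟩
  have h1 : t * w - G w ≤ complementary G t :=
    le_csSup (h.bddAbove_complementary ht) ⟨w, hw, rfl⟩
  have h2 : G w / l ≤ G w := div_le_self (h.nonneg hw.le) hl
  calc t / l * w - G w ≤ (t * w - G w) / l := by rw [sub_div, div_mul_eq_mul_div]; linarith
    _ ≤ complementary G t / l := by gcongr

end IsNFunction

lemma monotone_comp_max_zero {Φ : ℝ → ℝ} (hΦ : MonotoneOn Φ (Ici 0)) :
    Monotone fun t : ℝ => Φ (max t 0) := fun a b hab =>
  hΦ (mem_Ici.2 (le_max_right a 0)) (mem_Ici.2 (le_max_right b 0)) (max_le_max_right _ hab)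

lemma measurable_comp_of_monotoneOn {α : Type*} [MeasurableSpace α] {Φ : ℝ → ℝ}
    (hΦ : MonotoneOn Φ (Ici 0)) {f : α → ℝ} (hf : Measurable f) (hf0 : ∀ x, 0 ≤ f x) :
    Measurable fun x => Φ (f x) := by
  have := (monotone_comp_max_zero hΦ).measurable.comp hf
  simpa [Function.comp_def, max_eq_left (hf0 _)] using this

lemma aemeasurable_comp_of_monotoneOn {α : Type*} [MeasurableSpace α] {μ : Measure α} {Φ : ℝ → ℝ}
    (hΦ : MonotoneOn Φ (Ici 0)) {f : α → ℝ} (hf : AEMeasurable f μ) (hf0 : ∀ x, 0 ≤ f x) :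
    AEMeasurable (fun x => Φ (f x)) μ := by
  have := (monotone_comp_max_zero hΦ).measurable.comp_aemeasurable hf
  simpa [Function.comp_def, max_eq_left (hf0 _)] using this

/-! ### Luxemburg norms -/

section Luxemburg

variable {α F : Type*} [MeasurableSpace α] [NormedAddCommGroup F] {μ : Measure α}

lemma eLuxemburgNorm_le {Φ : ℝ → ℝ} {f : α → F} {l : ℝ} (hl : 0 < l)
    (h : ∫⁻ x, ENNReal.ofReal (Φ (‖f x‖ / l)) ∂μ ≤ 1) :
    eLuxemburgNorm Φ μ f ≤ ENNReal.ofReal l :=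
  iInf₂_le l ⟨hl, h⟩

lemma eLuxemburgNorm_mono_measure (Φ : ℝ → ℝ) (f : α → F) {ν : Measure α} (h : μ ≤ ν) :
    eLuxemburgNorm Φ μ f ≤ eLuxemburgNorm Φ ν f :=
  le_iInf₂ fun _ hl => eLuxemburgNorm_le hl.1 ((lintegral_mono' h le_rfl).trans hl.2)

/-- A bound by `c * l` for all admissible `l` passes to the infimum; `hc0` excludes `0 * ∞`. -/
lemma le_mul_eLuxemburgNorm {Φ : ℝ → ℝ} {f : α → F} {X c : ℝ≥0∞} (hc : c ≠ ⊤)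
    (hc0 : c = 0 → eLuxemburgNorm Φ μ f < ⊤)
    (h : ∀ l : ℝ, 0 < l → ∫⁻ x, ENNReal.ofReal (Φ (‖f x‖ / l)) ∂μ ≤ 1 →
      X ≤ c * ENNReal.ofReal l) : X ≤ c * eLuxemburgNorm Φ μ f := by
  rcases eq_or_ne c 0 with rfl | hc'
  · obtain ⟨l, hl⟩ := iInf_lt_iff.1 (hc0 rfl)
    obtain ⟨hl, -⟩ := iInf_lt_iff.1 hl
    simpa using h l hl.1 hl.2
  · rw [mul_comm, ← ENNReal.div_le_iff hc' hc]
    refine le_iInf₂ fun l hl => ?_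
    rw [ENNReal.div_le_iff hc' hc, mul_comm]
    exact h l hl.1 hl.2

/-- For `Φ` with the scaling property of convex functions vanishing at `0`, a finite modular gives a
finite Luxemburg norm. -/
lemma eLuxemburgNorm_lt_top {Φ : ℝ → ℝ}
    (hΦ : ∀ t l : ℝ, 0 ≤ t → 1 ≤ l → Φ (t / l) ≤ Φ t / l) {f : α → F}
    (hf : ∫⁻ x, ENNReal.ofReal (Φ ‖f x‖) ∂μ < ⊤) : eLuxemburgNorm Φ μ f < ⊤ := by
  set I := ∫⁻ x, ENNReal.ofReal (Φ ‖f x‖) ∂μ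
  set l : ℝ := I.toReal + 1
  have hl1 : 1 ≤ l := le_add_of_nonneg_left ENNReal.toReal_nonneg
  have hl : 0 < l := one_pos.trans_le hl1
  refine (eLuxemburgNorm_le hl ?_).trans_lt ENNReal.ofReal_lt_top
  calc ∫⁻ x, ENNReal.ofReal (Φ (‖f x‖ / l)) ∂μ
      ≤ ∫⁻ x, (ENNReal.ofReal l)⁻¹ * ENNReal.ofReal (Φ ‖f x‖) ∂μ := by
        refine lintegral_mono fun x => ?_
        rw [← ENNReal.ofReal_inv_of_pos hl, ← ENNReal.ofReal_mul (inv_nonneg.2 hl.le),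
          inv_mul_eq_div]
        exact ENNReal.ofReal_le_ofReal (hΦ _ _ (norm_nonneg _) hl1)
    _ = (ENNReal.ofReal l)⁻¹ * I := lintegral_const_mul' _ _ (by simp [hl])
    _ ≤ 1 := by
        rw [ENNReal.inv_mul_le_iff (by simp [hl]) ENNReal.ofReal_ne_top, mul_one]
        rw [← ENNReal.ofReal_toReal hf.ne]
        exact ENNReal.ofReal_le_ofReal (by simp [l])

variable {G g : ℝ → ℝ}

lemma IsNFunction.eLuxemburgNorm_lt_top (h : IsNFunction G g) {f : α → F}
    (hf : MemOrlicz G μ f) : eLuxemburgNorm G μ f < ⊤ :=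
  OrliczRadial.eLuxemburgNorm_lt_top (fun _ _ => h.div_le) hf.2

lemma IsNFunction.eLuxemburgNorm_complementary_lt_top (h : IsNFunction G g) [IsFiniteMeasure μ]
    {f : α → F} {b : ℝ} (hf : ∀ᵐ x ∂μ, ‖f x‖ ≤ b) :
    eLuxemburgNorm (complementary G) μ f < ⊤ := by
  refine OrliczRadial.eLuxemburgNorm_lt_top (fun _ _ => h.complementary_div_le) ?_
  calc ∫⁻ x, ENNReal.ofReal (complementary G ‖f x‖) ∂μ
      ≤ ∫⁻ _, ENNReal.ofReal (complementary G b) ∂μ := by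
        refine lintegral_mono_ae (hf.mono fun x hx => ENNReal.ofReal_le_ofReal ?_)
        exact h.complementary_monotoneOn (norm_nonneg _) ((norm_nonneg _).trans hx) hx
    _ < ⊤ := by
        rw [lintegral_const]
        exact ENNReal.mul_lt_top ENNReal.ofReal_lt_top (measure_lt_top _ _)

/-- Hölder's inequality, with the modular of the second factor bounded by `M` in place of `1`. -/
lemma IsNFunction.lintegral_mul_le (h : IsNFunction G g) {f : α → F}
    (hf : AEStronglyMeasurable f μ) {k : α → ℝ} {κ : ℝ} (hκ : 0 < κ) {M : ℝ≥0∞} (hM : M ≠ ⊤)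
    (hk : ∫⁻ x, ENNReal.ofReal (complementary G (‖k x‖ / κ)) ∂μ ≤ M) :
    ∫⁻ x, ‖f x‖ₑ * ‖k x‖ₑ ∂μ ≤ (1 + M) * ENNReal.ofReal κ * eLuxemburgNorm G μ f := by
  have hc0 : (1 + M) * ENNReal.ofReal κ ≠ 0 := by simp [hκ]
  have hct : (1 + M) * ENNReal.ofReal κ ≠ ⊤ :=
    ENNReal.mul_ne_top (by simp [hM]) ENNReal.ofReal_ne_top
  refine le_mul_eLuxemburgNorm hct (fun h0 => (hc0 h0).elim) fun l hl0 hl => ?_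
  have hpt : ∀ x, ‖f x‖ₑ * ‖k x‖ₑ ≤ ENNReal.ofReal l * ENNReal.ofReal κ *
      (ENNReal.ofReal (G (‖f x‖ / l)) + ENNReal.ofReal (complementary G (‖k x‖ / κ))) := by
    intro x
    refine le_trans (le_of_eq ?_) (mul_le_mul_right (h.ofReal_mul_le
      (div_nonneg (norm_nonneg (k x)) hκ.le) (div_nonneg (norm_nonneg (f x)) hl0.le)) _)
    rw [← ofReal_norm, ← ofReal_norm, ← ENNReal.ofReal_mul (norm_nonneg _),
      ← ENNReal.ofReal_mul hl0.le, ← ENNReal.ofReal_mul (div_nonneg (norm_nonneg _) hl0.le),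
      ← ENNReal.ofReal_mul (mul_nonneg hl0.le hκ.le)]
    congr 1
    have := hl0.ne'
    field_simp
  have hmeas : AEMeasurable (fun x => ENNReal.ofReal (G (‖f x‖ / l))) μ :=
    (aemeasurable_comp_of_monotoneOn h.monotoneOn (hf.norm.aemeasurable.div_const l)
      fun x => div_nonneg (norm_nonneg _) hl0.le).ennreal_ofReal
  calc ∫⁻ x, ‖f x‖ₑ * ‖k x‖ₑ ∂μ
      ≤ ∫⁻ x, ENNReal.ofReal l * ENNReal.ofReal κ * (ENNReal.ofReal (G (‖f x‖ / l)) +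
          ENNReal.ofReal (complementary G (‖k x‖ / κ))) ∂μ := lintegral_mono hpt
    _ = ENNReal.ofReal l * ENNReal.ofReal κ * (∫⁻ x, ENNReal.ofReal (G (‖f x‖ / l)) ∂μ +
          ∫⁻ x, ENNReal.ofReal (complementary G (‖k x‖ / κ)) ∂μ) := by
        rw [lintegral_const_mul' _ _ (by finiteness), lintegral_add_left' hmeas]
    _ ≤ ENNReal.ofReal l * ENNReal.ofReal κ * (1 + M) :=
        mul_le_mul_right (add_le_add hl hk) _
    _ = (1 + M) * ENNReal.ofReal κ * ENNReal.ofReal l := by ring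

end Luxemburg

/-! ### Polar coordinates -/

/-- The shell `{x | a < ‖x‖ < b}`. -/
def shell (E : Type*) [NormedAddCommGroup E] (a b : ℝ) : Set E := {x | ‖x‖ ∈ Ioo a b}

section Shell

variable {E : Type*} [NormedAddCommGroup E]

lemma measurableSet_shell [MeasurableSpace E] [OpensMeasurableSpace E] (a b : ℝ) :
    MeasurableSet (shell E a b) :=
  measurable_norm measurableSet_Ioo

lemma shell_subset_ball (a b : ℝ) : shell E a b ⊆ Metric.ball 0 b := fun x hx => by
  simpa using hx.2

end Shell

section Polar

variable {E : Type*} [NormedAddCommGroup E] [NormedSpace ℝ E] [MeasurableSpace E] [BorelSpace E]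
  [FiniteDimensional ℝ E] [Nontrivial E] (μ : Measure E) [μ.IsAddHaarMeasure]

lemma lintegral_polar {f : E → ℝ≥0∞} (hf : Measurable f) :
    ∫⁻ x, f x ∂μ = ∫⁻ s in Ioi (0 : ℝ), ENNReal.ofReal (s ^ (Module.finrank ℝ E - 1)) *
      ∫⁻ θ : Metric.sphere (0 : E) 1, f (s • (θ : E)) ∂μ.toSphere := by
  have hF : Measurable fun p : Metric.sphere (0 : E) 1 × Ioi (0 : ℝ) =>
      f ((p.2 : ℝ) • (p.1 : E)) := by fun_prop
  have hI : Measurable fun s : ℝ => ∫⁻ θ : Metric.sphere (0 : E) 1, f (s • (θ : E)) ∂μ.toSphere :=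
    Measurable.lintegral_prod_right'
      (f := fun p : ℝ × Metric.sphere (0 : E) 1 => f (p.1 • (p.2 : E))) (by fun_prop)
  calc ∫⁻ x, f x ∂μ = ∫⁻ x : ({(0)}ᶜ : Set E), f x ∂(μ.comap (↑)) := by
        rw [lintegral_subtype_comap (measurableSet_singleton _).compl f, restrict_compl_singleton]
    _ = ∫⁻ p, f ((p.2 : ℝ) • (p.1 : E))
          ∂μ.toSphere.prod (.volumeIoiPow (Module.finrank ℝ E - 1)) := by
        rw [← μ.measurePreserving_homeomorphUnitSphereProd.lintegral_comp hF]
        refine lintegral_congr fun x => ?_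
        have hx : ‖(x : E)‖ ≠ 0 := norm_ne_zero_iff.2 x.2
        simp [smul_smul, hx]
    _ = ∫⁻ s : Ioi (0 : ℝ), (∫⁻ θ, f ((s : ℝ) • (θ : E)) ∂μ.toSphere)
          ∂.volumeIoiPow (Module.finrank ℝ E - 1) := lintegral_prod_symm' _ hF
    _ = _ := by
        rw [Measure.volumeIoiPow]
        refine (lintegral_withDensity_eq_lintegral_mul _ (by fun_prop)
          (hI.comp measurable_subtype_coe)).trans ?_
        exact lintegral_subtype_comap measurableSet_Ioi fun s : ℝ =>
          ENNReal.ofReal (s ^ (Module.finrank ℝ E - 1)) *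
            ∫⁻ θ : Metric.sphere (0 : E) 1, f (s • (θ : E)) ∂μ.toSphere

lemma setLIntegral_shell {a b : ℝ} (ha : 0 ≤ a) {f : E → ℝ≥0∞} (hf : Measurable f) :
    ∫⁻ x in shell E a b, f x ∂μ =
      ∫⁻ s in Ioo a b, ENNReal.ofReal (s ^ (Module.finrank ℝ E - 1)) *
        ∫⁻ θ : Metric.sphere (0 : E) 1, f (s • (θ : E)) ∂μ.toSphere := by
  rw [← lintegral_indicator (measurableSet_shell a b),
    lintegral_polar μ (hf.indicator (measurableSet_shell a b)),
    ← lintegral_indicator measurableSet_Ioi, ← lintegral_indicator measurableSet_Ioo]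
  refine lintegral_congr fun s => ?_
  by_cases hs : s ∈ Ioo a b
  · have hs0 : 0 < s := ha.trans_lt hs.1
    rw [indicator_of_mem hs, indicator_of_mem (mem_Ioi.2 hs0)]
    congr 1
    refine lintegral_congr fun θ => indicator_of_mem ?_ _
    simpa [shell, norm_smul, abs_of_pos hs0] using hs
  · rw [indicator_of_notMem hs]
    by_cases hs0 : 0 < s
    · rw [indicator_of_mem (mem_Ioi.2 hs0)]
      have : ∀ θ : Metric.sphere (0 : E) 1,
          (shell E a b).indicator f (s • (θ : E)) = 0 := fun θ => by
        refine indicator_of_notMem ?_ _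
        simpa [shell, norm_smul, abs_of_pos hs0] using hs
      simp [this]
    · exact indicator_of_notMem hs0 _

lemma setLIntegral_shell_norm {r : ℝ} (hr : 0 ≤ r) {f : ℝ → ℝ≥0∞} (hf : Measurable f) :
    ∫⁻ x in shell E r 1, f ‖x‖ ∂μ =
      μ.toSphere univ * ∫⁻ s, f s ∂radialMeasure (Module.finrank ℝ E) r := by
  rw [setLIntegral_shell μ hr (by fun_prop), radialMeasure,
    lintegral_withDensity_eq_lintegral_mul _ (by fun_prop) hf,
    ← lintegral_const_mul' _ _ (measure_ne_top _ _)]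
  refine setLIntegral_congr_fun measurableSet_Ioo fun s hs => ?_
  have : ∀ θ : Metric.sphere (0 : E) 1, ‖s • (θ : E)‖ = s := fun θ => by
    simp [norm_smul, abs_of_pos (hr.trans_lt hs.1)]
  simp only [this, lintegral_const, Pi.mul_apply]
  ring

/-- The polar form of an almost everywhere statement. -/
lemma ae_ae_sphere {b : ℝ} {p : E → Prop} (hp : ∀ᵐ x ∂μ.restrict (Metric.ball 0 b), p x) :
    ∀ᵐ s : ℝ, s ∈ Ioo 0 b → ∀ᵐ θ : Metric.sphere (0 : E) 1 ∂μ.toSphere, p (s • (θ : E)) := by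
  obtain ⟨N, hpN, hN, hN0⟩ := exists_measurable_superset_of_null (ae_iff.1 hp)
  have hmeas : Measurable (N.indicator (1 : E → ℝ≥0∞)) := measurable_one.indicator hN
  have h0 : ∫⁻ x in shell E 0 b, N.indicator (1 : E → ℝ≥0∞) x ∂μ = 0 := by
    rw [lintegral_indicator_one hN, ← nonpos_iff_eq_zero, ← hN0]
    exact Measure.restrict_mono (shell_subset_ball 0 b) le_rfl N
  have hI : Measurable fun s : ℝ =>
      ∫⁻ θ : Metric.sphere (0 : E) 1, N.indicator (1 : E → ℝ≥0∞) (s • (θ : E)) ∂μ.toSphere :=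
    Measurable.lintegral_prod_right' (f := fun p : ℝ × Metric.sphere (0 : E) 1 =>
      N.indicator (1 : E → ℝ≥0∞) (p.1 • (p.2 : E))) (hmeas.comp (by fun_prop))
  rw [setLIntegral_shell μ le_rfl hmeas, lintegral_eq_zero_iff (by fun_prop),
    EventuallyEq, ae_restrict_iff' measurableSet_Ioo] at h0
  filter_upwards [h0] with s hs hsb
  have hpow : ENNReal.ofReal (s ^ (Module.finrank ℝ E - 1)) ≠ 0 := by simp [pow_pos hsb.1]
  have := (mul_eq_zero.1 (hs hsb)).resolve_left hpow
  rw [lintegral_eq_zero_iff (by fun_prop)] at this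
  filter_upwards [this] with θ hθ
  by_contra hpθ
  simp [indicator_of_mem (show s • (θ : E) ∈ N from hpN hpθ)] at hθ

lemma ae_norm_of_ae {q : ℝ → Prop} (hq : ∀ᵐ s : ℝ, s ∈ Ioo 0 1 → q s) :
    ∀ᵐ x ∂μ.restrict (Metric.ball (0 : E) 1), q ‖x‖ := by
  obtain ⟨N, hqN, hN, hN0⟩ := exists_measurable_superset_of_null (ae_iff.1 hq)
  have hmeas : Measurable (N.indicator (1 : ℝ → ℝ≥0∞)) := measurable_one.indicator hN
  have h0 : ∫⁻ x in shell E 0 1, N.indicator (1 : ℝ → ℝ≥0∞) ‖x‖ ∂μ = 0 := by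
    rw [setLIntegral_shell_norm μ le_rfl hmeas, lintegral_indicator_one hN]
    have hac : radialMeasure (Module.finrank ℝ E) 0 ≪ volume :=
      (withDensity_absolutelyContinuous _ _).trans Measure.restrict_le_self.absolutelyContinuous
    rw [hac hN0, mul_zero]
  rw [lintegral_eq_zero_iff (by fun_prop), EventuallyEq,
    ae_restrict_iff' (measurableSet_shell 0 1)] at h0
  rw [ae_restrict_iff' measurableSet_ball]
  have hne : ∀ᵐ x ∂μ, x ≠ 0 := by simp [ae_iff]
  filter_upwards [h0, hne] with x hx hx0 hxb
  have hxs : ‖x‖ ∈ Ioo (0 : ℝ) 1 := ⟨norm_pos_iff.2 hx0, by simpa using hxb⟩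
  by_contra hqx
  have hxN : ‖x‖ ∈ N := hqN (by simpa [hqx] using hxs)
  simpa [indicator_of_mem hxN] using hx hxs

end Polar

/-! ### Spherical integrals of test functions -/

section TestFunction

variable {n : ℕ}

namespace IsTestFunction

variable {Ω : Set (EuclideanSpace ℝ (Fin n))} {φ ψ : EuclideanSpace ℝ (Fin n) → ℝ}

lemma sub (hφ : IsTestFunction Ω φ) (hψ : IsTestFunction Ω ψ) :
    IsTestFunction Ω fun x => φ x - ψ x :=
  ⟨hφ.1.sub hψ.1, hφ.2.1.sub hψ.2.1,
    (tsupport_sub φ ψ).trans (union_subset hφ.2.2 hψ.2.2)⟩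

lemma differentiable (hφ : IsTestFunction Ω φ) : Differentiable ℝ φ :=
  hφ.1.differentiable (by simp)

lemma continuous_gradient (hφ : IsTestFunction Ω φ) : Continuous (gradient φ) :=
  (InnerProductSpace.toDual ℝ _).symm.continuous.comp (hφ.1.continuous_fderiv (by simp))

lemma gradient_sub (hφ : IsTestFunction Ω φ) (hψ : IsTestFunction Ω ψ)
    (x : EuclideanSpace ℝ (Fin n)) :
    gradient (fun x => φ x - ψ x) x = gradient φ x - gradient ψ x := by
  simp only [gradient]
  rw [fderiv_fun_sub (hφ.differentiable x) (hψ.differentiable x), map_sub]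

/-- The fundamental theorem of calculus along the segment from `r θ` to the boundary point `θ`. -/
lemma enorm_smul_le (hφ : IsTestFunction (unitBall n) φ) {r : ℝ} (hr : r ≤ 1)
    {θ : EuclideanSpace ℝ (Fin n)} (hθ : ‖θ‖ = 1) :
    ‖φ (r • θ)‖ₑ ≤ ∫⁻ s in Ioo r 1, ‖gradient φ (s • θ)‖ₑ := by
  have hφθ : φ ((1 : ℝ) • θ) = 0 := by
    refine image_eq_zero_of_notMem_tsupport fun h => ?_
    simpa [hθ] using hφ.2.2 h
  have hderiv : ∀ s : ℝ, HasDerivAt (fun s : ℝ => φ (s • θ)) (fderiv ℝ φ (s • θ) θ) s := fun s => by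
    have h1 : HasDerivAt (fun s : ℝ => s • θ) θ s := by
      simpa using (hasDerivAt_id s).smul_const θ
    exact (hφ.differentiable _).hasFDerivAt.comp_hasDerivAt s h1
  have hcont : Continuous fun s : ℝ => fderiv ℝ φ (s • θ) θ :=
    ((hφ.1.continuous_fderiv (by simp)).comp (by fun_prop)).clm_apply continuous_const
  have hFTC := intervalIntegral.integral_eq_sub_of_hasDerivAt (fun s _ => hderiv s)
    (hcont.intervalIntegrable r 1)
  simp only [hφθ, zero_sub] at hFTC
  rw [← enorm_neg, ← hFTC, intervalIntegral.integral_of_le hr,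
    Measure.restrict_congr_set Ioo_ae_eq_Ioc.symm]
  refine (enorm_integral_le_lintegral_enorm _).trans (lintegral_mono fun s => ?_)
  rw [← ofReal_norm, ← ofReal_norm]
  refine ENNReal.ofReal_le_ofReal ?_
  rw [← inner_gradient_left]
  simpa [hθ] using norm_inner_le_norm (𝕜 := ℝ) (gradient φ (s • θ)) θ

end IsTestFunction

/-- The surface integral of `φ` over the sphere of radius `s`, with the measure of the unit
sphere. -/
noncomputable def sphericalIntegral (φ : EuclideanSpace ℝ (Fin n) → ℝ) (s : ℝ) : ℝ :=
  ∫ θ : Metric.sphere (0 : EuclideanSpace ℝ (Fin n)) 1, φ (s • (θ : EuclideanSpace ℝ (Fin n)))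
    ∂(volume : Measure (EuclideanSpace ℝ (Fin n))).toSphere

lemma continuous_comp_smul_sphere {φ : EuclideanSpace ℝ (Fin n) → ℝ} (hφ : Continuous φ) (s : ℝ) :
    Continuous fun θ : Metric.sphere (0 : EuclideanSpace ℝ (Fin n)) 1 =>
      φ (s • (θ : EuclideanSpace ℝ (Fin n))) := by
  fun_prop

lemma integrable_comp_smul_sphere {φ : EuclideanSpace ℝ (Fin n) → ℝ} (hφ : Continuous φ) (s : ℝ) :
    Integrable (fun θ : Metric.sphere (0 : EuclideanSpace ℝ (Fin n)) 1 =>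
      φ (s • (θ : EuclideanSpace ℝ (Fin n))))
      (volume : Measure (EuclideanSpace ℝ (Fin n))).toSphere :=
  (continuous_comp_smul_sphere hφ s).integrable_of_hasCompactSupport
    (HasCompactSupport.of_compactSpace _)

lemma continuous_sphericalIntegral {φ : EuclideanSpace ℝ (Fin n) → ℝ} (hφ : Continuous φ) :
    Continuous (sphericalIntegral φ) := by
  have := continuous_parametric_integral_of_continuous
    (μ := (volume : Measure (EuclideanSpace ℝ (Fin n))).toSphere)
    (f := fun (s : ℝ) (θ : Metric.sphere (0 : EuclideanSpace ℝ (Fin n)) 1) =>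
      φ (s • (θ : EuclideanSpace ℝ (Fin n)))) (by fun_prop) isCompact_univ
  simp only [Measure.restrict_univ] at this
  exact this

lemma sphericalIntegral_sub {φ ψ : EuclideanSpace ℝ (Fin n) → ℝ} (hφ : Continuous φ)
    (hψ : Continuous ψ) (s : ℝ) :
    sphericalIntegral (fun x => φ x - ψ x) s = sphericalIntegral φ s - sphericalIntegral ψ s :=
  integral_sub (integrable_comp_smul_sphere hφ s) (integrable_comp_smul_sphere hψ s)

/-- In polar coordinates the volume element `s ^ (n - 1) ds dθ` absorbs the weight `‖x‖ ^ (1 - n)`,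
so that the surface integral of the radial increments becomes a volume integral. -/
lemma IsTestFunction.enorm_sphericalIntegral_le (hn : 1 ≤ n) {φ : EuclideanSpace ℝ (Fin n) → ℝ}
    (hφ : IsTestFunction (unitBall n) φ) {r : ℝ} (hr0 : 0 < r) (hr1 : r ≤ 1) :
    ‖sphericalIntegral φ r‖ₑ ≤
      ∫⁻ x in shell (EuclideanSpace ℝ (Fin n)) r 1, ‖gradient φ x‖ₑ * ‖‖x‖ ^ (1 - (n : ℤ))‖ₑ := by
  have : Nonempty (Fin n) := ⟨⟨0, hn⟩⟩
  have hgm : Measurable (gradient φ) := hφ.continuous_gradient.measurable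
  rw [setLIntegral_shell _ hr0.le (by fun_prop)]
  calc ‖sphericalIntegral φ r‖ₑ
      ≤ ∫⁻ θ : Metric.sphere (0 : EuclideanSpace ℝ (Fin n)) 1,
          ‖φ (r • (θ : EuclideanSpace ℝ (Fin n)))‖ₑ ∂Measure.toSphere volume :=
        enorm_integral_le_lintegral_enorm _
    _ ≤ ∫⁻ θ : Metric.sphere (0 : EuclideanSpace ℝ (Fin n)) 1, (∫⁻ s in Ioo r 1,
          ‖gradient φ (s • (θ : EuclideanSpace ℝ (Fin n)))‖ₑ) ∂Measure.toSphere volume :=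
        lintegral_mono fun θ => hφ.enorm_smul_le hr1 (by simp)
    _ = ∫⁻ s in Ioo r 1, ∫⁻ θ : Metric.sphere (0 : EuclideanSpace ℝ (Fin n)) 1,
          ‖gradient φ (s • (θ : EuclideanSpace ℝ (Fin n)))‖ₑ ∂Measure.toSphere volume :=
        lintegral_lintegral_swap (Measurable.aemeasurable (by fun_prop))
    _ = _ := by
        refine setLIntegral_congr_fun measurableSet_Ioo fun s hs => ?_
        have hs0 : 0 < s := hr0.trans hs.1
        have hnorm : ∀ θ : Metric.sphere (0 : EuclideanSpace ℝ (Fin n)) 1,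
            ‖s • (θ : EuclideanSpace ℝ (Fin n))‖ = s := fun θ => by
          simp [norm_smul, abs_of_pos hs0]
        have hone : ENNReal.ofReal (s ^ (n - 1)) * ‖s ^ (1 - (n : ℤ))‖ₑ = 1 := by
          rw [Real.enorm_of_nonneg (zpow_pos hs0 _).le, ← ENNReal.ofReal_mul (by positivity),
            ← zpow_natCast, ← zpow_add₀ hs0.ne', Nat.cast_sub hn]
          simp
        simp only [hnorm, finrank_euclideanSpace, Fintype.card_fin]
        rw [lintegral_mul_const' _ _ enorm_ne_top, mul_left_comm, hone, mul_one]

end TestFunction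

/-! ### The radial weight -/

section Weight

variable {n : ℕ}

lemma radialMeasure_eq_restrict (n : ℕ) (r : ℝ) :
    radialMeasure n r =
      (volume.withDensity fun s : ℝ => ENNReal.ofReal (s ^ (n - 1))).restrict (Ioo r 1) :=
  (restrict_withDensity measurableSet_Ioo _).symm

lemma radialMeasure_mono (n : ℕ) {r r' : ℝ} (h : r ≤ r') :
    radialMeasure n r' ≤ radialMeasure n r := by
  rw [radialMeasure_eq_restrict, radialMeasure_eq_restrict]
  exact Measure.restrict_mono (Ioo_subset_Ioo_left h) le_rfl

lemma ae_radialMeasure_mem (n : ℕ) (r : ℝ) : ∀ᵐ s ∂radialMeasure n r, s ∈ Ioo r 1 := by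
  rw [radialMeasure_eq_restrict]
  exact ae_restrict_mem measurableSet_Ioo

lemma isFiniteMeasure_radialMeasure (n : ℕ) {r : ℝ} (hr : 0 ≤ r) :
    IsFiniteMeasure (radialMeasure n r) := by
  refine isFiniteMeasure_withDensity (lt_of_le_of_lt (b := ∫⁻ _ in Ioo r 1, 1) ?_ (by simp)).ne
  refine setLIntegral_mono measurable_const fun s hs => ?_
  rw [← ENNReal.ofReal_one]
  exact ENNReal.ofReal_le_ofReal (pow_le_one₀ (hr.trans hs.1.le) hs.2.le)

/-- The weight `s ^ (1 - n)` is bounded away from the origin, hence has a finite norm there. In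
particular its real-valued norm is not the junk value `0`. -/
lemma IsNFunction.eLuxemburgNorm_weight_lt_top {G g : ℝ → ℝ} (h : IsNFunction G g) (hn : 1 ≤ n)
    {r : ℝ} (hr : 0 < r) :
    eLuxemburgNorm (complementary G) (radialMeasure n r) (fun s : ℝ => s ^ (1 - (n : ℤ))) < ⊤ := by
  have := isFiniteMeasure_radialMeasure n hr.le
  refine h.eLuxemburgNorm_complementary_lt_top (b := (r ^ (n - 1))⁻¹) ?_
  filter_upwards [ae_radialMeasure_mem n r] with s hs
  have hs0 : 0 < s := hr.trans hs.1
  have : s ^ (1 - (n : ℤ)) = (s ^ (n - 1))⁻¹ := by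
    rw [← zpow_natCast, ← zpow_neg, Nat.cast_sub hn]
    simp
  rw [this, Real.norm_of_nonneg (by positivity)]
  have := hs.1.le
  gcongr

/-- Hölder's inequality on the shell `r < ‖x‖ < 1` against the weight `‖x‖ ^ (1 - n)`, whose norm is
taken in one dimension. Passing from the volume to `s ^ (n - 1) ds` multiplies the modular of the
weight by the area of the unit sphere, which enters the constant. -/
lemma IsNFunction.setLIntegral_mul_weight_le {G g : ℝ → ℝ} (h : IsNFunction G g) (hn : 1 ≤ n)
    {F : Type*} [NormedAddCommGroup F] {f : EuclideanSpace ℝ (Fin n) → F}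
    (hf : AEStronglyMeasurable f (volume.restrict (unitBall n)))
    (hf' : eLuxemburgNorm G (volume.restrict (unitBall n)) f < ⊤) {r : ℝ} (hr : 0 < r) :
    ∫⁻ x in shell (EuclideanSpace ℝ (Fin n)) r 1, ‖f x‖ₑ * ‖‖x‖ ^ (1 - (n : ℤ))‖ₑ ≤
      (1 + (volume : Measure (EuclideanSpace ℝ (Fin n))).toSphere univ) *
        eLuxemburgNorm G (volume.restrict (unitBall n)) f *
        eLuxemburgNorm (complementary G) (radialMeasure n r) (fun s : ℝ => s ^ (1 - (n : ℤ))) := by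
  have : Nonempty (Fin n) := ⟨⟨0, hn⟩⟩
  have hsub : volume.restrict (shell (EuclideanSpace ℝ (Fin n)) r 1) ≤
      volume.restrict (unitBall n) := Measure.restrict_mono (shell_subset_ball r 1) le_rfl
  refine le_mul_eLuxemburgNorm (ENNReal.mul_ne_top (by finiteness) hf'.ne)
    (fun _ => h.eLuxemburgNorm_weight_lt_top hn hr) fun κ hκ hκ1 => ?_
  have hmeas : Measurable fun s : ℝ =>
      ENNReal.ofReal (complementary G (‖s ^ (1 - (n : ℤ))‖ / κ)) :=
    (measurable_comp_of_monotoneOn h.complementary_monotoneOn (by fun_prop)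
      fun s => by positivity).ennreal_ofReal
  have hk : ∫⁻ x in shell (EuclideanSpace ℝ (Fin n)) r 1,
      ENNReal.ofReal (complementary G (‖‖x‖ ^ (1 - (n : ℤ))‖ / κ)) ≤
        (volume : Measure (EuclideanSpace ℝ (Fin n))).toSphere univ := by
    rw [setLIntegral_shell_norm volume hr.le hmeas, finrank_euclideanSpace, Fintype.card_fin]
    exact mul_le_of_le_one_right' hκ1
  refine (h.lintegral_mul_le (hf.mono_measure hsub) hκ (measure_ne_top _ _) hk).trans ?_
  rw [mul_right_comm]
  gcongr
  exact eLuxemburgNorm_mono_measure G f hsub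

end Weight

/-! ### The limit of the spherical integrals -/

section Limit

variable {n : ℕ}

lemma exists_limit_of_uniformCauchySeqOn {m : ℕ → ℝ → ℝ} (hm : ∀ k, Continuous (m k))
    (hc : ∀ r ∈ Ioo (0 : ℝ) 1, UniformCauchySeqOn m atTop (Ioo r 1)) :
    ∃ w : ℝ → ℝ, ContinuousOn w (Ioo 0 1) ∧
      ∀ s ∈ Ioo (0 : ℝ) 1, Tendsto (fun k => m k s) atTop (𝓝 (w s)) := by
  have hlim : ∀ s, ∃ y, s ∈ Ioo (0 : ℝ) 1 → Tendsto (fun k => m k s) atTop (𝓝 y) := by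
    intro s
    by_cases hs : s ∈ Ioo (0 : ℝ) 1
    · obtain ⟨y, hy⟩ := cauchySeq_tendsto_of_complete
        ((hc (s / 2) ⟨by linarith [hs.1], by linarith [hs.1, hs.2]⟩).cauchySeq
          (x := s) ⟨by linarith [hs.1], hs.2⟩)
      exact ⟨y, fun _ => hy⟩
    · exact ⟨0, fun h => (hs h).elim⟩
  choose w hw using hlim
  refine ⟨w, fun s hs => ?_, hw⟩
  have hr : s / 2 ∈ Ioo (0 : ℝ) 1 := ⟨by linarith [hs.1], by linarith [hs.1, hs.2]⟩
  have hcont : ContinuousOn w (Ioo (s / 2) 1) :=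
    ((hc _ hr).tendstoUniformlyOn_of_tendsto fun t ht => hw t ⟨hr.1.trans ht.1, ht.2⟩).continuousOn
      (Frequently.of_forall fun k => (hm k).continuousOn)
  exact (hcont.continuousAt (Ioo_mem_nhds (by linarith [hs.1]) hs.2)).continuousWithinAt

/-- If continuous `φ k` converge to `u` in `L¹` of the unit ball with summable errors, then for a
radial `u` the spherical integrals of `φ k` recover `u` on almost every sphere. -/
lemma ae_tendsto_sphericalIntegral (hn : 1 ≤ n) {u : EuclideanSpace ℝ (Fin n) → ℝ}
    (hu : AEStronglyMeasurable u (volume.restrict (unitBall n))) {f : ℝ → ℝ}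
    (hf : ∀ᵐ x ∂(volume.restrict (unitBall n)), u x = f ‖x‖)
    {φ : ℕ → EuclideanSpace ℝ (Fin n) → ℝ} (hφ : ∀ k, Continuous (φ k))
    (hsum : ∑' k, ∫⁻ x in unitBall n, ‖u x - φ k x‖ₑ ≠ ⊤) :
    ∀ᵐ s : ℝ, s ∈ Ioo 0 1 → Tendsto (fun k => sphericalIntegral (φ k) s) atTop
      (𝓝 ((volume : Measure (EuclideanSpace ℝ (Fin n))).toSphere.real univ * f s)) := by
  have : Nonempty (Fin n) := ⟨⟨0, hn⟩⟩
  set u' := hu.mk u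
  have hu' : Measurable u' := hu.stronglyMeasurable_mk.measurable
  have hφm : ∀ k, Measurable (φ k) := fun k => (hφ k).measurable
  have huf : ∀ᵐ x ∂(volume.restrict (unitBall n)), u' x = f ‖x‖ := by
    filter_upwards [hf, hu.ae_eq_mk] with x h1 h2
    rw [← h1, h2]
  have hF : Measurable fun x => ∑' k, ‖u' x - φ k x‖ₑ := by fun_prop
  have hfin : ∫⁻ x in shell (EuclideanSpace ℝ (Fin n)) 0 1, ∑' k, ‖u' x - φ k x‖ₑ ≠ ⊤ := by
    refine ne_top_of_le_ne_top hsum ?_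
    calc ∫⁻ x in shell (EuclideanSpace ℝ (Fin n)) 0 1, ∑' k, ‖u' x - φ k x‖ₑ
        ≤ ∫⁻ x in unitBall n, ∑' k, ‖u' x - φ k x‖ₑ :=
          lintegral_mono_set (shell_subset_ball 0 1)
      _ = ∑' k, ∫⁻ x in unitBall n, ‖u' x - φ k x‖ₑ := lintegral_tsum fun k => by fun_prop
      _ = ∑' k, ∫⁻ x in unitBall n, ‖u x - φ k x‖ₑ := by
          congr 1 with k
          refine lintegral_congr_ae ?_
          filter_upwards [hu.ae_eq_mk] with x hx
          rw [hx]
  rw [setLIntegral_shell volume le_rfl hF] at hfin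
  have hI : Measurable fun s : ℝ => ∫⁻ θ : Metric.sphere (0 : EuclideanSpace ℝ (Fin n)) 1,
      (∑' k, ‖u' (s • (θ : EuclideanSpace ℝ (Fin n))) -
        φ k (s • (θ : EuclideanSpace ℝ (Fin n)))‖ₑ) ∂Measure.toSphere volume :=
    Measurable.lintegral_prod_right'
      (f := fun p : ℝ × Metric.sphere (0 : EuclideanSpace ℝ (Fin n)) 1 =>
        ∑' k, ‖u' (p.1 • (p.2 : EuclideanSpace ℝ (Fin n))) -
          φ k (p.1 • (p.2 : EuclideanSpace ℝ (Fin n)))‖ₑ) (by fun_prop)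
  have hae := ae_lt_top (by fun_prop) hfin
  rw [ae_restrict_iff' measurableSet_Ioo] at hae
  filter_upwards [hae, ae_ae_sphere volume huf] with s hs1 hs2 hs
  have hpow : ENNReal.ofReal (s ^ (Module.finrank ℝ (EuclideanSpace ℝ (Fin n)) - 1)) ≠ 0 := by
    simp [pow_pos hs.1]
  have hlt := ENNReal.lt_top_of_mul_ne_top_right (hs1 hs).ne hpow
  rw [lintegral_tsum fun k => Measurable.aemeasurable (by fun_prop)] at hlt
  rw [tendsto_iff_edist_tendsto_0]
  refine tendsto_of_tendsto_of_tendsto_of_le_of_le tendsto_const_nhds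
    (ENNReal.tendsto_atTop_zero_of_tsum_ne_top hlt.ne) (fun _ => zero_le) fun k => ?_
  have hconst : (volume : Measure (EuclideanSpace ℝ (Fin n))).toSphere.real univ * f s =
      ∫ _ : Metric.sphere (0 : EuclideanSpace ℝ (Fin n)) 1, f s ∂Measure.toSphere volume := by
    rw [integral_const, smul_eq_mul]
  rw [edist_comm, edist_eq_enorm_sub, hconst, sphericalIntegral,
    ← integral_sub (integrable_const _) (integrable_comp_smul_sphere (hφ k) s)]
  refine (enorm_integral_le_lintegral_enorm _).trans (lintegral_mono_ae ?_)
  filter_upwards [hs2 hs] with θ hθ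
  have hnorm : ‖s • (θ : EuclideanSpace ℝ (Fin n))‖ = s := by
    simp [norm_smul, abs_of_pos hs.1]
  rw [hθ, hnorm]

end Limit

/-! ### The continuous radial representative -/

section Representative

variable {n : ℕ} {G g : ℝ → ℝ}

/-- The general estimate with its explicit constant, in terms of the area of the unit sphere. -/
theorem IsNFunction.exists_isContinuousRadialRep (h : IsNFunction G g) (hn : 1 ≤ n)
    {u : EuclideanSpace ℝ (Fin n) → ℝ} {V : EuclideanSpace ℝ (Fin n) → EuclideanSpace ℝ (Fin n)}
    (hu : MemXrad G u V) :
    ∃ v : EuclideanSpace ℝ (Fin n) → ℝ, IsContinuousRadialRep u v ∧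
      ∀ x : EuclideanSpace ℝ (Fin n), 0 < ‖x‖ → ‖x‖ < 1 →
        |v x| ≤ (1 + (volume : Measure (EuclideanSpace ℝ (Fin n))).toSphere.real univ) /
            (volume : Measure (EuclideanSpace ℝ (Fin n))).toSphere.real univ *
          luxemburgNorm G (volume.restrict (unitBall n)) V *
            luxemburgNorm (complementary G) (radialMeasure n ‖x‖)
              (fun s : ℝ => s ^ (1 - (n : ℤ))) := by
  have : Nonempty (Fin n) := ⟨⟨0, hn⟩⟩
  obtain ⟨⟨⟨-, hGu, hGV⟩, happ⟩, f, hf⟩ := hu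
  set μ : Measure (EuclideanSpace ℝ (Fin n)) := volume.restrict (unitBall n) with hμ
  have : IsFiniteMeasure μ := ⟨by
    rw [hμ, Measure.restrict_apply_univ]
    exact measure_ball_lt_top⟩
  set σ : Measure (Metric.sphere (0 : EuclideanSpace ℝ (Fin n)) 1) :=
    (volume : Measure (EuclideanSpace ℝ (Fin n))).toSphere with hσ
  have hσpos : 0 < σ.real univ := by
    have : NeZero σ := ⟨Measure.toSphere_ne_zero _⟩
    exact measureReal_univ_pos
  set K : ℝ → ℝ≥0∞ := fun r => (1 + σ univ) *
    eLuxemburgNorm (complementary G) (radialMeasure n r) (fun s : ℝ => s ^ (1 - (n : ℤ))) with hK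
  have hKtop : ∀ r, 0 < r → K r ≠ ⊤ := fun r hr =>
    ENNReal.mul_ne_top (by finiteness) (h.eLuxemburgNorm_weight_lt_top hn hr).ne
  have hKanti : ∀ r s, r ≤ s → K s ≤ K r := fun r s hrs =>
    mul_le_mul_right (eLuxemburgNorm_mono_measure _ _ (radialMeasure_mono n hrs)) _
  set M := eLuxemburgNorm G μ V
  have hM : M < ⊤ := h.eLuxemburgNorm_lt_top hGV
  choose φ hφ hφε using fun k : ℕ => happ ((2⁻¹ : ℝ≥0∞) ^ k) (ENNReal.pow_pos (by simp) k)
  set a : ℕ → ℝ≥0∞ := fun k => eLuxemburgNorm G μ fun x => u x - φ k x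
  set b : ℕ → ℝ≥0∞ := fun k => eLuxemburgNorm G μ fun x => V x - gradient (φ k) x
  have hak : ∀ k, a k ≤ 2⁻¹ ^ k := fun k => le_self_add.trans (hφε k).le
  have hbk : ∀ k, b k ≤ 2⁻¹ ^ k := fun k => le_add_self.trans (hφε k).le
  have hbtop : ∀ k, b k < ⊤ := fun k => (hbk k).trans_lt (by finiteness)
  have hb0 : Tendsto b atTop (𝓝 0) :=
    tendsto_of_tendsto_of_tendsto_of_le_of_le tendsto_const_nhds
      (ENNReal.tendsto_pow_atTop_nhds_zero_of_lt_one (by simp)) (fun _ => zero_le) hbk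
  have hVφ : ∀ k, AEStronglyMeasurable (fun x => V x - gradient (φ k) x) μ := fun k =>
    hGV.1.sub (hφ k).continuous_gradient.aestronglyMeasurable
  -- Hölder's inequality, applied to each term of a splitting of the gradient of a test function.
  have hsplit : ∀ (ψ : EuclideanSpace ℝ (Fin n) → ℝ)
      (F₁ F₂ : EuclideanSpace ℝ (Fin n) → EuclideanSpace ℝ (Fin n)),
      IsTestFunction (unitBall n) ψ → AEStronglyMeasurable F₁ μ → AEStronglyMeasurable F₂ μ →
      eLuxemburgNorm G μ F₁ < ⊤ → eLuxemburgNorm G μ F₂ < ⊤ →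
      (∀ x, gradient ψ x = F₁ x - F₂ x) → ∀ r ∈ Ioo (0 : ℝ) 1,
      ‖sphericalIntegral ψ r‖ₑ ≤ K r * (eLuxemburgNorm G μ F₁ + eLuxemburgNorm G μ F₂) := by
    intro ψ F₁ F₂ hψ hF₁ hF₂ hN₁ hN₂ hgrad r hr
    have hsub : volume.restrict (shell (EuclideanSpace ℝ (Fin n)) r 1) ≤ μ :=
      Measure.restrict_mono (shell_subset_ball r 1) le_rfl
    calc ‖sphericalIntegral ψ r‖ₑ
        ≤ ∫⁻ x in shell (EuclideanSpace ℝ (Fin n)) r 1,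
            ‖gradient ψ x‖ₑ * ‖‖x‖ ^ (1 - (n : ℤ))‖ₑ :=
          hψ.enorm_sphericalIntegral_le hn hr.1 hr.2.le
      _ ≤ ∫⁻ x in shell (EuclideanSpace ℝ (Fin n)) r 1,
            (‖F₁ x‖ₑ * ‖‖x‖ ^ (1 - (n : ℤ))‖ₑ + ‖F₂ x‖ₑ * ‖‖x‖ ^ (1 - (n : ℤ))‖ₑ) := by
          refine lintegral_mono fun x => ?_
          rw [hgrad, ← add_mul]
          gcongr
          exact enorm_sub_le
      _ = (∫⁻ x in shell (EuclideanSpace ℝ (Fin n)) r 1, ‖F₁ x‖ₑ * ‖‖x‖ ^ (1 - (n : ℤ))‖ₑ) +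
            ∫⁻ x in shell (EuclideanSpace ℝ (Fin n)) r 1, ‖F₂ x‖ₑ * ‖‖x‖ ^ (1 - (n : ℤ))‖ₑ :=
          lintegral_add_left' ((hF₁.mono_measure hsub).enorm.mul (by fun_prop)) _
      _ ≤ (1 + σ univ) * eLuxemburgNorm G μ F₁ * eLuxemburgNorm (complementary G)
            (radialMeasure n r) (fun s : ℝ => s ^ (1 - (n : ℤ))) +
          (1 + σ univ) * eLuxemburgNorm G μ F₂ * eLuxemburgNorm (complementary G)
            (radialMeasure n r) (fun s : ℝ => s ^ (1 - (n : ℤ))) :=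
          add_le_add (h.setLIntegral_mul_weight_le hn hF₁ hN₁ hr.1)
            (h.setLIntegral_mul_weight_le hn hF₂ hN₂ hr.1)
      _ = K r * (eLuxemburgNorm G μ F₁ + eLuxemburgNorm G μ F₂) := by
          rw [hK]
          ring
  have hbound : ∀ k, ∀ r ∈ Ioo (0 : ℝ) 1, ‖sphericalIntegral (φ k) r‖ₑ ≤ K r * (M + b k) :=
    fun k => hsplit (φ k) V _ (hφ k) hGV.1 (hVφ k) hM (hbtop k) fun x => by simp
  have hdiff : ∀ j k, ∀ r ∈ Ioo (0 : ℝ) 1,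
      edist (sphericalIntegral (φ j) r) (sphericalIntegral (φ k) r) ≤ K r * (b k + b j) := by
    intro j k r hr
    rw [edist_eq_enorm_sub, ← sphericalIntegral_sub (hφ j).1.continuous (hφ k).1.continuous]
    refine hsplit _ _ _ ((hφ j).sub (hφ k)) (hVφ k) (hVφ j) (hbtop k) (hbtop j) (fun x => ?_) r hr
    rw [(hφ j).gradient_sub (hφ k)]
    abel
  have hcauchy : ∀ r ∈ Ioo (0 : ℝ) 1,
      UniformCauchySeqOn (fun k => sphericalIntegral (φ k)) atTop (Ioo r 1) := by
    intro r hr U hU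
    obtain ⟨ε, hε, hεU⟩ := mem_uniformity_edist.1 hU
    have hlim : Tendsto (fun p : ℕ × ℕ => K r * (b p.2 + b p.1)) (atTop ×ˢ atTop) (𝓝 0) := by
      have h1 : Tendsto (fun p : ℕ × ℕ => b p.2 + b p.1) (atTop ×ˢ atTop) (𝓝 (0 + 0)) :=
        (hb0.comp tendsto_snd).add (hb0.comp tendsto_fst)
      simpa using ENNReal.Tendsto.const_mul h1 (Or.inr (hKtop r hr.1))
    filter_upwards [hlim.eventually_lt_const hε] with p hp s hs
    refine hεU ((hdiff p.1 p.2 s ⟨hr.1.trans hs.1, hs.2⟩).trans_lt (lt_of_le_of_lt ?_ hp))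
    gcongr
    exact hKanti r s hs.1.le
  obtain ⟨w, hwc, hw⟩ := exists_limit_of_uniformCauchySeqOn
    (fun k => continuous_sphericalIntegral (hφ k).1.continuous) hcauchy
  have hwbound : ∀ r ∈ Ioo (0 : ℝ) 1, ‖w r‖ₑ ≤ K r * M := by
    intro r hr
    have h1 : Tendsto (fun k => K r * (M + b k)) atTop (𝓝 (K r * (M + 0))) :=
      ENNReal.Tendsto.const_mul (tendsto_const_nhds.add hb0) (Or.inr (hKtop r hr.1))
    rw [add_zero] at h1
    exact le_of_tendsto_of_tendsto' (hw r hr).enorm h1 fun k => hbound k r hr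
  -- Convergence in the Orlicz space implies convergence in `L¹`, by Hölder's inequality with `1`.
  have hsum : ∑' k, ∫⁻ x in unitBall n, ‖u x - φ k x‖ₑ ≠ ⊤ := by
    have h1 : eLuxemburgNorm (complementary G) μ (fun _ => (1 : ℝ)) < ⊤ :=
      h.eLuxemburgNorm_complementary_lt_top (b := 1) (by simp)
    obtain ⟨κ, hκ⟩ := iInf_lt_iff.1 h1
    obtain ⟨hκ, -⟩ := iInf_lt_iff.1 hκ
    have h2 : ∀ k, ∫⁻ x in unitBall n, ‖u x - φ k x‖ₑ ≤
        (1 + 1) * ENNReal.ofReal κ * 2⁻¹ ^ k := by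
      intro k
      have := h.lintegral_mul_le (f := fun x => u x - φ k x)
        (hGu.1.sub (hφ k).1.continuous.aestronglyMeasurable) hκ.1 ENNReal.one_ne_top hκ.2
      simp only [enorm_one, mul_one] at this
      refine this.trans ?_
      gcongr
      exact hak k
    refine ne_top_of_le_ne_top ?_ (ENNReal.tsum_le_tsum h2)
    rw [ENNReal.tsum_mul_left, ENNReal.tsum_geometric_two]
    finiteness
  have hwf : ∀ᵐ s : ℝ, s ∈ Ioo 0 1 → w s = σ.real univ * f s := by
    filter_upwards [ae_tendsto_sphericalIntegral hn hGu.1 hf (fun k => (hφ k).1.continuous) hsum]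
      with s hs hs01
    exact tendsto_nhds_unique (hw s hs01) (hs hs01)
  have hae : ∀ᵐ x ∂μ, w ‖x‖ = σ.real univ * f ‖x‖ := ae_norm_of_ae volume hwf
  refine ⟨fun x => w ‖x‖ / σ.real univ, ⟨?_, ?_, ?_⟩, ?_⟩
  · filter_upwards [hae, hf] with x hx1 hx2
    rw [hx1, hx2, mul_div_cancel_left₀ _ hσpos.ne']
  · refine (hwc.comp continuous_norm.continuousOn fun x hx => ?_).div_const _
    exact ⟨norm_pos_iff.2 hx.2, by simpa using hx.1⟩
  · intro x _ y _ hxy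
    simp only [hxy]
  · intro x hx0 hx1
    have hle := hwbound ‖x‖ ⟨hx0, hx1⟩
    have hle' := ENNReal.toReal_mono (ENNReal.mul_ne_top (hKtop _ hx0) hM.ne) hle
    rw [toReal_enorm, Real.norm_eq_abs, hK, ENNReal.toReal_mul, ENNReal.toReal_mul,
      ENNReal.toReal_add ENNReal.one_ne_top (measure_ne_top _ _), ENNReal.toReal_one] at hle'
    rw [abs_div, abs_of_pos hσpos, div_mul_eq_mul_div, div_mul_eq_mul_div]
    refine div_le_div_of_nonneg_right (hle'.trans (le_of_eq ?_)) hσpos.le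
    simp only [luxemburgNorm, Measure.real]
    ring

end Representative

/-! ### Powers -/

section Power

lemma isNFunction_rpow {p : ℝ} (hp : 1 < p) :
    IsNFunction (fun t : ℝ => t ^ p) (fun t : ℝ => p * t ^ (p - 1)) where
  rightContinuous t _ :=
    (continuous_const.mul (Real.continuous_rpow_const (by linarith))).continuousWithinAt
  pos t ht := by positivity
  mono a ha b _ hab :=
    mul_le_mul_of_nonneg_left (Real.rpow_le_rpow ha hab (by linarith)) (by linarith)
  map_zero := by rw [Real.zero_rpow (by linarith), mul_zero]
  tendsto_atTop := (tendsto_rpow_atTop (by linarith)).const_mul_atTop (by linarith)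
  eq_integral t _ := by
    rw [intervalIntegral.integral_const_mul, integral_rpow (Or.inl (by linarith)), sub_add_cancel,
      Real.zero_rpow (by linarith), sub_zero, mul_div_cancel₀ _ (by linarith)]

lemma complementary_rpow_le {p q : ℝ} (hpq : p.HolderConjugate q) {t : ℝ} (ht : 0 ≤ t) :
    complementary (fun t : ℝ => t ^ p) t ≤ t ^ q := by
  refine csSup_le ⟨_, 1, one_pos, rfl⟩ ?_
  rintro _ ⟨w, hw, rfl⟩
  have h1 := Real.young_inequality_of_nonneg hw.le ht hpq
  have h2 : w ^ p / p ≤ w ^ p := div_le_self (by positivity) hpq.lt.le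
  have h3 : t ^ q / q ≤ t ^ q := div_le_self (by positivity) hpq.symm.lt.le
  linarith [mul_comm t w]

/-- The weight satisfies `‖s ^ (1 - n)‖ ≤ c r ^ (1 - n / p)`, by explicit integration of
`s ^ ((1 - n) q + n - 1)` over `(r, ∞)`. -/
lemma luxemburgNorm_weight_rpow_le {n : ℕ} (hn : 1 ≤ n) {p q : ℝ} (hpq : p.HolderConjugate q)
    (hpn : p < n) {r : ℝ} (hr : 0 < r) :
    luxemburgNorm (complementary fun t : ℝ => t ^ p) (radialMeasure n r)
      (fun s : ℝ => s ^ (1 - (n : ℤ))) ≤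
        ((p - 1) / (n - p)) ^ q⁻¹ * r ^ (1 - (n : ℝ) / p) := by
  have hp1 : 0 < p - 1 := sub_pos.2 hpq.lt
  have hp0 : 0 < p := hpq.pos
  have hnp : 0 < (n : ℝ) - p := sub_pos.2 hpn
  have hq : q = p / (p - 1) := hpq.conjugate_eq
  set c := (p - 1) / ((n : ℝ) - p)
  have hc : 0 < c := div_pos hp1 hnp
  set l := c ^ q⁻¹ * r ^ (1 - (n : ℝ) / p)
  have hl : 0 < l := by positivity
  set e := (p - (n : ℝ)) / (p - 1) with he
  have he0 : e < 0 := div_neg_of_neg_of_pos (by linarith) hp1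
  have hlq : l ^ q = c * r ^ e := by
    rw [Real.mul_rpow (by positivity) (by positivity), ← Real.rpow_mul hc.le,
      inv_mul_cancel₀ hpq.symm.ne_zero, Real.rpow_one, ← Real.rpow_mul hr.le, hq, he]
    congr 2
    field_simp
  refine ENNReal.toReal_le_of_le_ofReal hl.le (eLuxemburgNorm_le hl ?_)
  have hint : IntegrableOn (fun s : ℝ => (l ^ q)⁻¹ * s ^ (e - 1)) (Ioi r) :=
    (integrableOn_Ioi_rpow_of_lt (by linarith) hr).const_mul _
  have hpt : ∀ s ∈ Ioo r 1, s ^ (n - 1) * (‖s ^ (1 - (n : ℤ))‖ / l) ^ q =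
      (l ^ q)⁻¹ * s ^ (e - 1) := by
    intro s hs
    have hs0 : 0 < s := hr.trans hs.1
    rw [Real.norm_of_nonneg (by positivity), Real.div_rpow (by positivity) hl.le,
      ← Real.rpow_natCast, ← Real.rpow_intCast, ← Real.rpow_mul hs0.le, mul_div_assoc',
      ← Real.rpow_add hs0, div_eq_inv_mul]
    congr 2
    push_cast [Nat.cast_sub hn]
    rw [hq, he]
    field_simp
    ring
  rw [radialMeasure, lintegral_withDensity_eq_lintegral_mul₀' (by fun_prop)
    ((measurable_comp_of_monotoneOn (isNFunction_rpow hpq.lt).complementary_monotoneOn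
      (by fun_prop) fun s => by positivity).ennreal_ofReal.aemeasurable)]
  calc _ ≤ ∫⁻ s in Ioo r 1, ENNReal.ofReal ((l ^ q)⁻¹ * s ^ (e - 1)) := by
        refine setLIntegral_mono' measurableSet_Ioo fun s hs => ?_
        have hs0 : 0 < s := hr.trans hs.1
        rw [Pi.mul_apply, ← ENNReal.ofReal_mul (by positivity), ← hpt s hs]
        refine ENNReal.ofReal_le_ofReal ?_
        gcongr
        exact complementary_rpow_le hpq (by positivity)
    _ ≤ ∫⁻ s in Ioi r, ENNReal.ofReal ((l ^ q)⁻¹ * s ^ (e - 1)) :=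
        lintegral_mono_set fun s hs => hs.1
    _ = ENNReal.ofReal (∫ s in Ioi r, (l ^ q)⁻¹ * s ^ (e - 1)) := by
        refine (ofReal_integral_eq_lintegral_ofReal hint ?_).symm
        filter_upwards [ae_restrict_mem measurableSet_Ioi] with s hs
        have hs0 : 0 < s := hr.trans hs
        positivity
    _ = 1 := by
        rw [integral_const_mul, integral_Ioi_rpow_of_lt (by linarith) hr, sub_add_cancel, hlq]
        have hce : -r ^ e / e = c * r ^ e := by
          have h1 : p - (n : ℝ) ≠ 0 := by linarith
          have h2 : (n : ℝ) - p ≠ 0 := by linarith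
          simp only [c, he]
          field_simp
          ring
        rw [hce, inv_mul_cancel₀ (by positivity), ENNReal.ofReal_one]

section

variable {α F : Type*} [MeasurableSpace α] [NormedAddCommGroup F] {μ : Measure α} {f : α → F}

lemma MemOrlicz.memLp {p : ℝ} (hp : 0 < p) (hf : MemOrlicz (fun t : ℝ => t ^ p) μ f) :
    MemLp f (ENNReal.ofReal p) μ := by
  refine ⟨hf.1, ?_⟩
  rw [eLpNorm_lt_top_iff_lintegral_rpow_enorm_lt_top (by simpa using hp) ENNReal.ofReal_ne_top,
    ENNReal.toReal_ofReal hp.le]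
  refine lt_of_eq_of_lt (lintegral_congr fun x => ?_) hf.2
  rw [← ofReal_norm, ENNReal.ofReal_rpow_of_nonneg (norm_nonneg _) hp.le]

lemma luxemburgNorm_rpow_le_eLpNorm {p : ℝ} (hp : 0 < p) (hf : MemLp f (ENNReal.ofReal p) μ) :
    luxemburgNorm (fun t : ℝ => t ^ p) μ f ≤ (eLpNorm f (ENNReal.ofReal p) μ).toReal := by
  refine le_of_forall_gt_imp_ge_of_dense fun l hl => ?_
  have hl0 : 0 < l := ENNReal.toReal_nonneg.trans_lt hl
  refine ENNReal.toReal_le_of_le_ofReal hl0.le (eLuxemburgNorm_le hl0 ?_)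
  have hle : eLpNorm f (ENNReal.ofReal p) μ ≤ ENNReal.ofReal l :=
    (ENNReal.le_ofReal_iff_toReal_le hf.2.ne hl0.le).2 hl.le
  rw [eLpNorm_eq_lintegral_rpow_enorm_toReal (by simpa using hp) ENNReal.ofReal_ne_top,
    ENNReal.toReal_ofReal hp.le, one_div, ENNReal.rpow_inv_le_iff hp] at hle
  have hlp0 : ENNReal.ofReal l ^ p ≠ 0 := by simp [hl0]
  have hlpt : ENNReal.ofReal l ^ p ≠ ⊤ := by finiteness
  calc ∫⁻ x, ENNReal.ofReal ((‖f x‖ / l) ^ p) ∂μ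
      = ∫⁻ x, (ENNReal.ofReal l ^ p)⁻¹ * ‖f x‖ₑ ^ p ∂μ := by
        refine lintegral_congr fun x => ?_
        rw [← ENNReal.ofReal_rpow_of_nonneg (by positivity) hp.le, ENNReal.ofReal_div_of_pos hl0,
          ENNReal.div_rpow_of_nonneg _ _ hp.le, ofReal_norm, ENNReal.div_eq_inv_mul]
    _ = (ENNReal.ofReal l ^ p)⁻¹ * ∫⁻ x, ‖f x‖ₑ ^ p ∂μ :=
        lintegral_const_mul' _ _ (ENNReal.inv_ne_top.2 hlp0)
    _ ≤ 1 := by rwa [ENNReal.inv_mul_le_iff hlp0 hlpt, mul_one]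

end

end Power

end OrliczRadial

/-- First part: the general estimate, with a constant depending only on `n`. Second part: the case
of powers `G t = t ^ p`, `1 < p < n`, with a constant depending only on `n` and `p`. -/
theorem proposition3p2 (n : ℕ) (hn : 1 ≤ n) :
    (∃ C : ℝ, 0 < C ∧
      ∀ G g : ℝ → ℝ, IsNFunction G g → GrowthCondition G g →
      ∀ (u : EuclideanSpace ℝ (Fin n) → ℝ)
        (gradu : EuclideanSpace ℝ (Fin n) → EuclideanSpace ℝ (Fin n)),
        MemXrad G u gradu →
        ∃ v : EuclideanSpace ℝ (Fin n) → ℝ, IsContinuousRadialRep u v ∧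
          ∀ x : EuclideanSpace ℝ (Fin n), 0 < ‖x‖ → ‖x‖ < 1 →
            |v x| ≤ C * luxemburgNorm G (volume.restrict (unitBall n)) gradu *
              luxemburgNorm (complementary G) (radialMeasure n ‖x‖)
                (fun s : ℝ => s ^ (1 - (n : ℤ)))) ∧
    (∀ p : ℝ, 1 < p → p < n → ∃ C : ℝ, 0 < C ∧
      ∀ (u : EuclideanSpace ℝ (Fin n) → ℝ)
        (gradu : EuclideanSpace ℝ (Fin n) → EuclideanSpace ℝ (Fin n)),
        MemXrad (fun t : ℝ => t ^ p) u gradu →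
        ∃ v : EuclideanSpace ℝ (Fin n) → ℝ, IsContinuousRadialRep u v ∧
          ∀ x : EuclideanSpace ℝ (Fin n), 0 < ‖x‖ → ‖x‖ < 1 →
            |v x| ≤ C * ‖x‖ ^ (1 - (n : ℝ) / p) *
              (eLpNorm gradu (ENNReal.ofReal p) (volume.restrict (unitBall n))).toReal) := by
  have : Nonempty (Fin n) := ⟨⟨0, hn⟩⟩
  set σ := (volume : Measure (EuclideanSpace ℝ (Fin n))).toSphere.real univ
  have hσ : 0 < σ := by
    have : NeZero (volume : Measure (EuclideanSpace ℝ (Fin n))).toSphere :=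
      ⟨Measure.toSphere_ne_zero _⟩
    exact measureReal_univ_pos
  refine ⟨⟨(1 + σ) / σ, by positivity, fun G g h _ u gradu hu =>
    h.exists_isContinuousRadialRep hn hu⟩, fun p hp hpn => ?_⟩
  have hpq := Real.HolderConjugate.conjExponent hp
  have hp1 : 0 < p - 1 := by linarith
  have hnp : 0 < (n : ℝ) - p := by linarith
  refine ⟨(1 + σ) / σ * ((p - 1) / (n - p)) ^ (p.conjExponent)⁻¹, by positivity,
    fun u gradu hu => ?_⟩
  obtain ⟨v, hv, hbound⟩ := (isNFunction_rpow hp).exists_isContinuousRadialRep hn hu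
  refine ⟨v, hv, fun x hx0 hx1 => (hbound x hx0 hx1).trans ?_⟩
  have hV := luxemburgNorm_rpow_le_eLpNorm (by linarith)
    (hu.1.1.2.2.memLp (p := p) (by linarith))
  have hw := luxemburgNorm_weight_rpow_le hn hpq hpn hx0
  have hV0 : 0 ≤ (eLpNorm gradu (ENNReal.ofReal p) (volume.restrict (unitBall n))).toReal :=
    ENNReal.toReal_nonneg
  calc _ ≤ (1 + σ) / σ *
        (eLpNorm gradu (ENNReal.ofReal p) (volume.restrict (unitBall n))).toReal *
          (((p - 1) / (n - p)) ^ (p.conjExponent)⁻¹ * ‖x‖ ^ (1 - (n : ℝ) / p)) := by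
        refine mul_le_mul (mul_le_mul_of_nonneg_left hV (by positivity)) hw
          ENNReal.toReal_nonneg (by positivity)
    _ = _ := by ring
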